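/- Let $z\in\mathbf C\setminus\{0\}$ and let $v=(v_+,v_-,v_0):\mathbf R\to\mathbf C^3$ be any solution on $\mathbf R$ of $$-i\,\partial_s\begin{pmatrix}v_+\\v_-\\v_0\end{pmatrix}=\begin{pmatrix}s&0&z/\sqrt2\\0&-s&\bar z/\sqrt2\\\bar z/\sqrt2&z/\sqrt2&0\end{pmatrix}\begin{pmatrix}v_+\\v_-\\v_0\end{pmatrix}.$$ Then there exist $(\alpha^+,\alpha^-,\alpha^0)\in\mathbf C^3$ and $(\omega^+,\omega^-,\omega^0)\in\mathbf C^3$ such that, for each $\ell\in\{+,-,0\}$ (read as $+1,-1,0$ in the exponents), $$v_\ell(s)=\exp\Big[\ell\,i\Big(\frac{s^2}2+\frac{|z|^2}2\ln|s|\Big)\Big]\alpha^\ell+O\Big(\frac{|z|^2}{s}\Big)\quad(s\to-\infty),$$ $$v_\ell(s)=\exp\Big[\ell\,i\Big(\frac{s^2}2+\frac{|z|^2}2\ln|s|\Big)\Big]\omega^\ell+O\Big(\frac{|z|^2}{s}\Big)\quad(s\to+\infty),$$ where the $O$ is for the given $z$ and the given solution $v$. Moreover $$\begin{pmatrix}\omega^+\\\omega^-\\\omega^0\end{pmatrix}=S(z)\begin{pmatrix}\alpha^+\\\alpha^-\\\alpha^0\end{pmatrix},$$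 $$S(z)=\begin{pmatrix} e^{-\pi|z|^2/2}&i\,\Omega(z)^2\,[1-e^{-\pi|z|^2/2}]&\sqrt2\,e^{i\pi/4}\,\Omega(z)\theta(z)\\ -i\,\overline{\Omega(z)}^2\,[1-e^{-\pi|z|^2/2}]&e^{-\pi|z|^2/2}&-\sqrt2\,e^{-i\pi/4}\,\overline{\Omega(z)}\theta(z)\\ -\sqrt2\,e^{-i\pi/4}\,\overline{\Omega(z)}\theta(z)&\sqrt2\,e^{i\pi/4}\,\Omega(z)\theta(z)&2e^{-\pi|z|^2/2}-1 \end{pmatrix},$$ with $$\Omega(z)=\frac{z}{|z|}\,\frac{\Gamma\big(1-i\frac{|z|^2}4\big)}{\big|\Gamma\big(1-i\frac{|z|^2}4\big)\big|},\qquad \theta(z)=\sqrt{1-e^{-\pi|z|^2/2}}\;e^{-\pi|z|^2/4}.$$ -/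

import Mathlib

noncomputable section

open Complex Filter Asymptotics

namespace PJT

/-- The pseudo Jahn-Teller matrix `V_PJT(s, z)`. The components of a vector are listed in the
order `+`, `-`, `0`. -/
def V (s : ℝ) (z : ℂ) : Matrix (Fin 3) (Fin 3) ℂ :=
  !![(s : ℂ), 0, z / (√2 : ℝ);
     0, -(s : ℂ), star z / (√2 : ℝ);
     star z / (√2 : ℝ), z / (√2 : ℝ), 0]

/-- `v = (v_+, v_-, v_0)` is a solution on the whole real line of `-i ∂_s v = V_PJT(s, z) v`. -/
def IsSolution (z : ℂ) (v : ℝ → Fin 3 → ℂ) : Prop :=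
  Differentiable ℝ v ∧ ∀ s : ℝ, (-I) • deriv v s = (V s z).mulVec (v s)

/-- The value `ℓ ∈ {+1, -1, 0}` attached to the components `+`, `-`, `0`. -/
def mode : Fin 3 → ℝ := ![1, -1, 0]

/-- The oscillating factor `exp [ℓ i (s² / 2 + (|z|² / 2) ln |s|)]`. -/
def osc (z : ℂ) (ℓ : Fin 3) (s : ℝ) : ℂ :=
  Complex.exp (((mode ℓ * (s ^ 2 / 2 + ‖z‖ ^ 2 / 2 * Real.log |s|) : ℝ) : ℂ) * I)

/-- The phase `Ω(z) = (z / |z|) Γ(1 - i |z|² / 4) / |Γ(1 - i |z|² / 4)|`. -/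
def Ω (z : ℂ) : ℂ :=
  z / (‖z‖ : ℂ) *
    (Complex.Gamma (1 - I * ((‖z‖ ^ 2 / 4 : ℝ) : ℂ)) /
      (‖Complex.Gamma (1 - I * ((‖z‖ ^ 2 / 4 : ℝ) : ℂ))‖ : ℂ))

/-- `θ(z) = √(1 - e^{-π |z|² / 2}) e^{-π |z|² / 4}`. -/
def θ (z : ℂ) : ℝ :=
  √(1 - Real.exp (-Real.pi * ‖z‖ ^ 2 / 2)) * Real.exp (-Real.pi * ‖z‖ ^ 2 / 4)

/-- `e^{-π |z|² / 2}`. -/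
def decay (z : ℂ) : ℝ := Real.exp (-Real.pi * ‖z‖ ^ 2 / 2)

/-- The phase `e^{i π / 4}`. -/
def eighth : ℂ := Complex.exp (I * (Real.pi / 4 : ℝ))

/-- The phase `e^{-i π / 4}`. -/
def eighthInv : ℂ := Complex.exp (-(I * (Real.pi / 4 : ℝ)))

/-- The scattering matrix `S(z)`, rows and columns in the order `+`, `-`, `0`. -/
def S (z : ℂ) : Matrix (Fin 3) (Fin 3) ℂ :=
  !![(decay z : ℂ), I * Ω z ^ 2 * (1 - decay z), (√2 : ℝ) * eighth * Ω z * θ z;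
     -I * star (Ω z) ^ 2 * (1 - decay z), (decay z : ℂ),
       -(√2 : ℝ) * eighthInv * star (Ω z) * θ z;
     -(√2 : ℝ) * eighthInv * star (Ω z) * θ z, (√2 : ℝ) * eighth * Ω z * θ z,
       2 * (decay z : ℂ) - 1]

end PJT

end

/-!
The system is the spin one version of the Landau-Zener system
`-i ∂_s (a, b) = ½ [[s, z], [z̄, -s]] (a, b)`: if `(a, b)` solves the latter then `(a², b², √2 a b)`
solves the former. Hence `S z` is the symmetric square of the Landau-Zener scattering matrix
`[[p, t], [-t̄, p]]`, with `p = e ^ (-π |z|² / 4)` and `t = e ^ (i π / 4) Ω z √(1 - p²)` (`S_eq`).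

The two level problem is solved explicitly. With `μ = |z|² / 4`, the function
`e ^ (i s² / 4) ∫₀^∞ r ^ (-i μ) e ^ (-r² / 2 - w r) dr` at `w = e ^ (-i π / 4) s` is the lower
component of a solution, and on the positive half line Watson's lemma shows that this solution is
asymptotically `(η e ^ (i (s² / 4 + μ ln s)), 0)`, where `η` is a multiple of `Γ (1 - i μ)`. No
analysis at `-∞`, where the integral has a saddle point, is needed: the reflection
`(a (-s), -b (-s))` of a solution is a solution, so that the scattering matrix is determined by the
values of one solution at `0` and its amplitude at `+∞`. With norm one, they give
`p = |a 0|² - |b 0|²` and `t = 2 η² ā 0 b̄ 0`. The values at `0` are those of `Γ` at `1 - i μ / 2`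
and `1 / 2 - i μ / 2`: the reflection formula gives `p`, and the duplication formula expresses the
phase of `t` through `Γ (1 - i μ)` (`exists_normalized_twoLevel`).

Together with `(-b̄, ā)` this solution yields an orthonormal basis of solutions of the three level
system with known behaviour at `+∞`. The coefficients of a given solution in this basis are its
inner products with the basis, which are constant (`IsThreeLevel.inner_eq`). This yields the
asymptotics of every solution at `+∞` (`IsThreeLevel.isBigO`), hence by reflection at `-∞`, and the
relation between the two amplitudes becomes a polynomial identity.
-/

open MeasureTheory Set Filter Topology Asymptotics
open scoped ComplexConjugate

namespace PJT

/-! ### Laplace transforms -/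

/-- A Laplace transform that converges absolutely at the real point `σ` may be differentiated under
the integral sign on the half plane `σ < re w`: half of the gap `re w - σ` absorbs the factor `r`
that comes from differentiating the exponential. -/
theorem hasDerivAt_laplace {f : ℝ → ℂ} {σ : ℝ} {w : ℂ}
    (hf : IntegrableOn (fun r : ℝ => f r * Complex.exp (-σ * r)) (Ioi 0)) (hw : σ < w.re) :
    IntegrableOn (fun r : ℝ => f r * Complex.exp (-w * r)) (Ioi 0) ∧
    HasDerivAt (fun w : ℂ => ∫ r in Ioi (0 : ℝ), f r * Complex.exp (-w * r))
      (∫ r in Ioi (0 : ℝ), -(r * f r * Complex.exp (-w * r))) w := by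
  set δ : ℝ := (w.re - σ) / 2 with hδ
  have hδ0 : 0 < δ := by rw [hδ]; linarith
  have hmeas (w : ℂ) : AEStronglyMeasurable (fun r : ℝ => f r * Complex.exp (-w * r))
      (volume.restrict (Ioi 0)) := by
    have h : AEStronglyMeasurable (fun r : ℝ => Complex.exp ((σ - w) * r))
      (volume.restrict (Ioi 0)) := (by fun_prop : Continuous _).aestronglyMeasurable
    refine (hf.aestronglyMeasurable.mul h).congr (.of_forall fun r => ?_)
    simp only [Pi.mul_apply]
    rw [mul_assoc, ← Complex.exp_add]
    ring_nf
  have hnorm (w : ℂ) (r : ℝ) : ‖Complex.exp (-w * r)‖ = Real.exp (-w.re * r) := by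
    rw [Complex.norm_exp]; simp
  have hint : IntegrableOn (fun r : ℝ => f r * Complex.exp (-w * r)) (Ioi 0) := by
    refine Integrable.mono hf (hmeas w) ?_
    filter_upwards [ae_restrict_mem measurableSet_Ioi] with r hr
    rw [mem_Ioi] at hr
    rw [norm_mul, norm_mul, hnorm, ← Complex.ofReal_neg, ← Complex.ofReal_mul,
      Complex.norm_exp_ofReal]
    gcongr
  refine ⟨hint, ?_⟩
  refine (hasDerivAt_integral_of_dominated_loc_of_deriv_le
    (F := fun w (r : ℝ) => f r * Complex.exp (-w * r))
    (F' := fun w (r : ℝ) => -(r * f r * Complex.exp (-w * r)))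
    (bound := fun r => δ⁻¹ * ‖f r * Complex.exp (-σ * r)‖)
    (Metric.ball_mem_nhds w hδ0) (.of_forall hmeas) hint ?_ ?_ (hf.norm.const_mul _) ?_).2
  · have h : AEStronglyMeasurable (fun r : ℝ => -(r : ℂ))
      (volume.restrict (Ioi 0)) := (by fun_prop : Continuous _).aestronglyMeasurable
    refine (h.mul (hmeas w)).congr (.of_forall fun r => ?_)
    simp only [Pi.mul_apply]
    ring
  · filter_upwards [ae_restrict_mem measurableSet_Ioi] with r hr w' hw'
    rw [mem_Ioi] at hr
    have hre : σ + δ ≤ w'.re := by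
      have h1 : |(w' - w).re| ≤ ‖w' - w‖ := Complex.abs_re_le_norm _
      have h2 : ‖w' - w‖ < δ := by simpa [dist_eq_norm] using hw'
      have h3 := (abs_le.1 (h1.trans h2.le)).1
      rw [Complex.sub_re] at h3
      linarith
    rw [norm_neg, norm_mul, norm_mul, norm_mul, hnorm, ← Complex.ofReal_neg, ← Complex.ofReal_mul,
      Complex.norm_exp_ofReal, Complex.norm_real, Real.norm_of_nonneg hr.le]
    have h1 : δ * r ≤ Real.exp (δ * r) := by linarith [Real.add_one_le_exp (δ * r)]
    have h2 : r ≤ δ⁻¹ * Real.exp (δ * r) := by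
      rw [inv_mul_eq_div, le_div_iff₀ hδ0]; linarith
    calc r * ‖f r‖ * Real.exp (-w'.re * r)
        ≤ (δ⁻¹ * Real.exp (δ * r)) * ‖f r‖ * Real.exp (-(σ + δ) * r) := by
          gcongr
      _ = δ⁻¹ * (‖f r‖ * (Real.exp (δ * r) * Real.exp (-(σ + δ) * r))) := by ring
      _ = _ := by rw [← Real.exp_add]; ring_nf
  · refine .of_forall fun r w' _ => ?_
    have h : HasDerivAt (fun w : ℂ => -w * r) (-1 * (r : ℂ)) w' :=
      (hasDerivAt_id w').neg.mul_const _
    convert! h.cexp.const_mul (f r) using 1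
    ring

theorem integrableOn_cpow_mul_exp {c : ℂ} (hc : -1 < c.re) {σ : ℝ} (hσ : 0 < σ) :
    IntegrableOn (fun r : ℝ => (r : ℂ) ^ c * Complex.exp (-σ * r)) (Ioi 0) := by
  have h := integrableOn_rpow_mul_exp_neg_mul_rpow hc one_pos hσ
  refine Integrable.mono h ?_ ?_
  · refine ContinuousOn.aestronglyMeasurable (fun r hr => ?_) measurableSet_Ioi
    have : ContinuousAt (fun r : ℝ => (r : ℂ) ^ c) r :=
      Complex.continuousAt_ofReal_cpow_const _ _ (.inr (ne_of_gt hr))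
    exact (this.mul (by fun_prop)).continuousWithinAt
  · filter_upwards [ae_restrict_mem measurableSet_Ioi] with r hr
    rw [norm_mul, Complex.norm_cpow_eq_rpow_re_of_pos hr, ← Complex.ofReal_neg,
      ← Complex.ofReal_mul, Complex.norm_exp_ofReal, norm_mul,
      Real.norm_of_nonneg (Real.exp_nonneg _),
      Real.norm_of_nonneg (Real.rpow_nonneg (le_of_lt hr) _), Real.rpow_one]

theorem integrableOn_cpow_mul_gaussian {c : ℂ} (hc : -1 < c.re) (σ : ℝ) :
    IntegrableOn (fun r : ℝ => ((r : ℂ) ^ c * Complex.exp (-(r : ℂ) ^ 2 / 2)) *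
      Complex.exp (-σ * r)) (Ioi 0) := by
  have h := (integrableOn_rpow_mul_exp_neg_mul_sq (b := 1 / 4) (by norm_num) hc).const_mul
    (Real.exp (σ ^ 2))
  refine Integrable.mono h ?_ ?_
  · refine ContinuousOn.aestronglyMeasurable (fun r hr => ?_) measurableSet_Ioi
    have : ContinuousAt (fun r : ℝ => (r : ℂ) ^ c) r :=
      Complex.continuousAt_ofReal_cpow_const _ _ (.inr (ne_of_gt hr))
    exact ((this.mul (by fun_prop)).mul (by fun_prop)).continuousWithinAt
  · filter_upwards [ae_restrict_mem measurableSet_Ioi] with r hr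
    have h1 : Complex.exp (-(r : ℂ) ^ 2 / 2) = ((Real.exp (-r ^ 2 / 2) : ℝ) : ℂ) := by
      push_cast; rfl
    have h2 : Complex.exp (-σ * r) = ((Real.exp (-σ * r) : ℝ) : ℂ) := by push_cast; rfl
    rw [norm_mul, norm_mul, Complex.norm_cpow_eq_rpow_re_of_pos hr, h1, h2, Complex.norm_real,
      Complex.norm_real, norm_mul, norm_mul, Real.norm_of_nonneg (Real.exp_nonneg _),
      Real.norm_of_nonneg (Real.exp_nonneg _), Real.norm_of_nonneg (Real.exp_nonneg _),
      Real.norm_of_nonneg (Real.exp_nonneg _),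
      Real.norm_of_nonneg (Real.rpow_nonneg (le_of_lt hr) _), mul_assoc, ← Real.exp_add,
      mul_left_comm, ← Real.exp_add]
    have : 0 ≤ r ^ c.re := Real.rpow_nonneg (le_of_lt hr) _
    refine mul_le_mul_of_nonneg_left (Real.exp_le_exp.2 ?_) this
    nlinarith [sq_nonneg (r / 2 + σ)]

/-- The Laplace transform of a complex power at a complex point of the right half plane. It follows
from the case of real `w` by the identity theorem. -/
theorem integral_cpow_mul_exp_neg_mul {a w : ℂ} (ha : 0 < a.re) (hw : 0 < w.re) :
    ∫ r in Ioi (0 : ℝ), (r : ℂ) ^ (a - 1) * Complex.exp (-w * r) = w ^ (-a) * Complex.Gamma a := by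
  have hopen : IsOpen {w : ℂ | 0 < w.re} := isOpen_lt continuous_const Complex.continuous_re
  have ha' : -1 < (a - 1).re := by simpa using ha
  have h1 : AnalyticOnNhd ℂ (fun w : ℂ => ∫ r in Ioi (0 : ℝ),
      (r : ℂ) ^ (a - 1) * Complex.exp (-w * r)) {w : ℂ | 0 < w.re} := by
    refine DifferentiableOn.analyticOnNhd (fun w hw => ?_) hopen
    exact (hasDerivAt_laplace (integrableOn_cpow_mul_exp ha' (half_pos hw))
      (half_lt_self hw)).2.differentiableAt.differentiableWithinAt
  have h2 : AnalyticOnNhd ℂ (fun w : ℂ => w ^ (-a) * Complex.Gamma a) {w : ℂ | 0 < w.re} := by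
    refine DifferentiableOn.analyticOnNhd (fun w hw => ?_) hopen
    have : w ∈ Complex.slitPlane := .inl hw
    exact ((differentiableAt_id.cpow (differentiableAt_const _) this).mul_const
      _).differentiableWithinAt
  have hconn : IsPreconnected {w : ℂ | 0 < w.re} := (convex_halfSpace_re_gt 0).isPreconnected
  refine h1.eqOn_of_preconnected_of_frequently_eq h2 hconn (z₀ := 1) (by simp) ?_ hw
  have htend : Tendsto (fun n : ℕ => 1 + ((1 / ((n : ℝ) + 1) : ℝ) : ℂ)) atTop (𝓝[≠] 1) := by
    refine tendsto_nhdsWithin_iff.2 ⟨?_, .of_forall fun n => ?_⟩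
    · have := (Complex.continuous_ofReal.tendsto 0).comp
        (tendsto_one_div_add_atTop_nhds_zero_nat (𝕜 := ℝ))
      simpa using (tendsto_const_nhds (x := (1 : ℂ))).add this
    · have : (0 : ℝ) < 1 / ((n : ℝ) + 1) := by positivity
      simp only [mem_compl_iff, mem_singleton_iff, add_eq_left, Complex.ofReal_eq_zero]
      exact this.ne'
  refine htend.frequently (Frequently.of_forall fun n => ?_)
  set x : ℝ := 1 + 1 / ((n : ℝ) + 1)
  have hx : 0 < x := by positivity
  have hxc : 1 + ((1 / ((n : ℝ) + 1) : ℝ) : ℂ) = (x : ℂ) := by simp [x]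
  rw [hxc]
  have := Complex.integral_cpow_mul_exp_neg_mul_Ioi ha hx
  rw [one_div, Complex.inv_cpow _ _ (by
    rw [Complex.arg_ofReal_of_nonneg hx.le]; exact Real.pi_pos.ne), ← Complex.cpow_neg] at this
  simpa only [neg_mul] using this

/-! ### A parabolic cylinder integral -/

/-- The integral `∫₀^∞ r ^ c e ^ (-r² / 2 - w r) dr`, an integral representation of the parabolic
cylinder functions. It converges for `-1 < re c` and is then entire in `w`. -/
noncomputable def moment (c w : ℂ) : ℂ :=
  ∫ r in Ioi (0 : ℝ), ((r : ℂ) ^ c * Complex.exp (-(r : ℂ) ^ 2 / 2)) * Complex.exp (-w * r)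

theorem integrableOn_moment {c : ℂ} (hc : -1 < c.re) (w : ℂ) :
    IntegrableOn (fun r : ℝ => ((r : ℂ) ^ c * Complex.exp (-(r : ℂ) ^ 2 / 2)) *
      Complex.exp (-w * r)) (Ioi 0) :=
  (hasDerivAt_laplace (integrableOn_cpow_mul_gaussian hc (w.re - 1)) (by linarith)).1

theorem hasDerivAt_moment {c : ℂ} (hc : -1 < c.re) (w : ℂ) :
    HasDerivAt (moment c) (-moment (c + 1) w) w := by
  convert! (hasDerivAt_laplace (integrableOn_cpow_mul_gaussian hc (w.re - 1))
    (by linarith : w.re - 1 < w.re)).2 using 1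
  rw [integral_neg, moment]
  congr 1
  refine setIntegral_congr_fun measurableSet_Ioi fun r hr => ?_
  rw [Complex.cpow_add _ _ (Complex.ofReal_ne_zero.2 (ne_of_gt hr)), Complex.cpow_one]
  ring

/-- Integration by parts: the integral over `(0, ∞)` of the derivative of
`r ^ (c + 1) e ^ (-r² / 2 - w r)` vanishes. -/
theorem moment_add_two {c : ℂ} (hc : -1 < c.re) (w : ℂ) :
    moment (c + 2) w + w * moment (c + 1) w = (c + 1) * moment c w := by
  have hc1 : -1 < (c + 1).re := by rw [Complex.add_re, Complex.one_re]; linarith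
  have hc2 : -1 < (c + 2).re := by rw [Complex.add_re, Complex.re_ofNat]; linarith
  have i0 := (integrableOn_moment hc w).const_mul (c + 1)
  have i1 := (integrableOn_moment hc1 w).const_mul w
  have i2 := integrableOn_moment hc2 w
  have hder : ∀ r ∈ Ioi (0 : ℝ), HasDerivAt
      (fun r : ℝ => ((r : ℂ) ^ (c + 1) * Complex.exp (-(r : ℂ) ^ 2 / 2)) * Complex.exp (-w * r))
      ((c + 1) * (((r : ℂ) ^ c * Complex.exp (-(r : ℂ) ^ 2 / 2)) * Complex.exp (-w * r)) -
        (((r : ℂ) ^ (c + 2) * Complex.exp (-(r : ℂ) ^ 2 / 2)) * Complex.exp (-w * r) +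
        w * (((r : ℂ) ^ (c + 1) * Complex.exp (-(r : ℂ) ^ 2 / 2)) * Complex.exp (-w * r)))) r := by
    intro r hr
    have hr0 : (r : ℂ) ≠ 0 := Complex.ofReal_ne_zero.2 (ne_of_gt hr)
    have hslit : (r : ℂ) ∈ Complex.slitPlane := Complex.ofReal_mem_slitPlane.2 hr
    have hid := hasDerivAt_id (r : ℂ)
    have h1 := hid.cpow_const (c := c + 1) hslit
    have h2 : HasDerivAt (fun r : ℂ => -r ^ 2 / 2) (-(r : ℂ)) (r : ℂ) := by
      convert! (hid.pow 2).neg.div_const 2 using 1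
      simp
      ring
    have h3 : HasDerivAt (fun r : ℂ => -w * r) (-w) (r : ℂ) := by
      simpa using hid.const_mul (-w)
    have h := ((h1.mul h2.cexp).mul h3.cexp).comp_ofReal
    convert! h using 1
    simp only [id, add_sub_cancel_right, Pi.mul_apply]
    rw [Complex.cpow_add _ _ hr0, Complex.cpow_add _ _ hr0, Complex.cpow_one, Complex.cpow_ofNat]
    ring
  have hlim := tendsto_zero_of_hasDerivAt_of_integrableOn_Ioi hder (i0.sub (i2.add i1))
    (integrableOn_moment hc1 w)
  have hcont : ContinuousWithinAt
      (fun r : ℝ => ((r : ℂ) ^ (c + 1) * Complex.exp (-(r : ℂ) ^ 2 / 2)) * Complex.exp (-w * r))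
      (Ici 0) 0 := by
    have : ContinuousAt (fun r : ℝ => (r : ℂ) ^ (c + 1)) 0 :=
      Complex.continuousAt_ofReal_cpow_const _ _ (.inl (by
        rw [Complex.add_re, Complex.one_re]; linarith))
    exact ((this.mul (by fun_prop)).mul (by fun_prop)).continuousWithinAt
  have h := integral_Ioi_of_hasDerivAt_of_tendsto hcont hder (i0.sub (i2.add i1)) hlim
  have hc0 : c + 1 ≠ 0 := fun h => by
    have := congrArg Complex.re h
    rw [Complex.add_re, Complex.one_re, Complex.zero_re] at this
    linarith
  have hsum : IntegrableOn (fun r : ℝ =>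
      ((r : ℂ) ^ (c + 2) * Complex.exp (-(r : ℂ) ^ 2 / 2)) * Complex.exp (-w * r) +
      w * (((r : ℂ) ^ (c + 1) * Complex.exp (-(r : ℂ) ^ 2 / 2)) * Complex.exp (-w * r)))
      (Ioi 0) := i2.add i1
  rw [integral_sub i0 hsum, integral_add i2 i1, integral_const_mul, integral_const_mul,
    Complex.ofReal_zero, Complex.zero_cpow hc0] at h
  simp only [moment]
  linear_combination -h

/-- At `w = 0` the substitution `r² ↦ r` turns `moment` into a Gamma integral. -/
theorem moment_zero {c : ℂ} (hc : -1 < c.re) :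
    moment c 0 = (2 : ℂ) ^ ((c - 1) / 2) * Complex.Gamma ((c + 1) / 2) := by
  have h1 : moment c 0 = mellin (fun t : ℝ =>
      (fun x : ℝ => Complex.exp (-(1 / 2 : ℂ) * x)) (t ^ (2 : ℝ))) (c + 1) := by
    rw [moment, mellin]
    refine setIntegral_congr_fun measurableSet_Ioi fun r _ => ?_
    simp only [neg_zero, zero_mul, Complex.exp_zero, mul_one, add_sub_cancel_right, smul_eq_mul,
      Real.rpow_ofNat]
    push_cast
    ring_nf
  have ha : 0 < ((c + 1) / 2).re := by
    rw [Complex.div_ofNat_re, Complex.add_re, Complex.one_re]; linarith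
  have h3 := integral_cpow_mul_exp_neg_mul ha (w := 1 / 2) (by simp)
  rw [h1, mellin_comp_rpow (fun x : ℝ => Complex.exp (-(1 / 2 : ℂ) * x)), mellin]
  simp only [smul_eq_mul, Complex.ofReal_ofNat] at h3 ⊢
  rw [h3, one_div, Complex.inv_cpow _ _ (by
    rw [Complex.ofNat_arg]; exact Real.pi_pos.ne), ← Complex.cpow_neg, neg_neg,
    show (c + 1) / 2 = (c - 1) / 2 + 1 by ring, Complex.cpow_add _ _ two_ne_zero, Complex.cpow_one]
  simp
  ring

/-- Watson's lemma for `moment`: dropping the Gaussian factor leaves a Laplace transform of a power,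
and `|e ^ (-r² / 2) - 1| ≤ r²` bounds the error. -/
theorem norm_moment_sub_le {c w : ℂ} (hc : -1 < c.re) (hw : 0 < w.re) :
    ‖moment c w - w ^ (-(c + 1)) * Complex.Gamma (c + 1)‖ ≤
      (1 / w.re) ^ (c.re + 3) * Real.Gamma (c.re + 3) := by
  have i1 := integrableOn_moment hc w
  have i2 := (hasDerivAt_laplace (integrableOn_cpow_mul_exp hc (half_pos hw))
    (half_lt_self hw)).1
  have h := integral_cpow_mul_exp_neg_mul (a := c + 1) (w := w) (by
    rw [Complex.add_re, Complex.one_re]; linarith) hw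
  rw [add_sub_cancel_right] at h
  rw [← h, moment, ← integral_sub i1 i2,
    ← Real.integral_rpow_mul_exp_neg_mul_Ioi (by linarith : 0 < c.re + 3) hw]
  refine norm_integral_le_of_norm_le ?_ ?_
  · have := integrableOn_rpow_mul_exp_neg_mul_rpow (s := c.re + 3 - 1) (by linarith) one_pos hw
    simpa only [Real.rpow_one, neg_mul, IntegrableOn] using this
  · filter_upwards [ae_restrict_mem measurableSet_Ioi] with r hr
    rw [mem_Ioi] at hr
    have h1 : Complex.exp (-(r : ℂ) ^ 2 / 2) = ((Real.exp (-r ^ 2 / 2) : ℝ) : ℂ) := by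
      push_cast; rfl
    have h2 : ‖Complex.exp (-w * r)‖ = Real.exp (-(w.re * r)) := by
      rw [Complex.norm_exp]; simp
    have h3 : ‖Complex.exp (-(r : ℂ) ^ 2 / 2) - 1‖ ≤ r ^ 2 := by
      rw [h1, ← Complex.ofReal_one, ← Complex.ofReal_sub, Complex.norm_real, Real.norm_eq_abs,
        abs_le]
      have e1 := Real.add_one_le_exp (-r ^ 2 / 2)
      have e2 : Real.exp (-r ^ 2 / 2) ≤ 1 := Real.exp_le_one_iff.2 (by nlinarith [sq_nonneg r])
      constructor <;> nlinarith [sq_nonneg r]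
    calc _ = ‖(r : ℂ) ^ c * Complex.exp (-w * r) * (Complex.exp (-(r : ℂ) ^ 2 / 2) - 1)‖ := by
          congr 1; ring
      _ ≤ r ^ c.re * Real.exp (-(w.re * r)) * r ^ 2 := by
          rw [norm_mul, norm_mul, Complex.norm_cpow_eq_rpow_re_of_pos hr, h2]
          gcongr
      _ = _ := by
          rw [show c.re + 3 - 1 = c.re + (2 : ℕ) by push_cast; ring, Real.rpow_add hr,
            Real.rpow_natCast]
          ring

/-! ### Gamma values -/

/-- The reflection formula at `i y`, since `Γ (1 - i y)` and `Γ (1 + i y) = i y Γ (i y)` are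
conjugate. -/
theorem norm_Gamma_one_sub_sq {y : ℝ} (hy : y ≠ 0) :
    ‖Complex.Gamma (1 - Complex.I * y)‖ ^ 2 = Real.pi * y / Real.sinh (Real.pi * y) := by
  have h := Complex.Gamma_mul_Gamma_one_sub (Complex.I * y)
  have h0 : Complex.I * y ≠ 0 := mul_ne_zero Complex.I_ne_zero (Complex.ofReal_ne_zero.2 hy)
  have h1 := Complex.Gamma_add_one _ h0
  have hconj : Complex.I * y + 1 = conj (1 - Complex.I * y) := by
    simp [add_comm]
  rw [hconj, Complex.Gamma_conj] at h1
  have hsin : Complex.sin (Real.pi * (Complex.I * y)) = Complex.sinh (Real.pi * y) * Complex.I := by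
    rw [← Complex.sin_mul_I]; ring_nf
  have hs : Complex.sinh (Real.pi * y) ≠ 0 := by
    have : Real.sinh (Real.pi * y) ≠ 0 := fun h => by
      rw [Real.sinh_eq_zero] at h
      exact mul_ne_zero Real.pi_ne_zero hy h
    exact_mod_cast this
  rw [← Complex.ofReal_inj]
  push_cast
  rw [← Complex.mul_conj', h1, mul_left_comm, mul_comm (Complex.Gamma (1 - _)), h, hsin]
  have := Complex.I_ne_zero
  field_simp

/-- The reflection formula on the line `re = 1 / 2`, where `1 - s` is the conjugate of `s`. -/
theorem norm_Gamma_half_sub_sq (y : ℝ) :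
    ‖Complex.Gamma (1 / 2 - Complex.I * y)‖ ^ 2 = Real.pi / Real.cosh (Real.pi * y) := by
  have h := Complex.Gamma_mul_Gamma_one_sub (1 / 2 - Complex.I * y)
  have hconj : 1 - (1 / 2 - Complex.I * y) = conj (1 / 2 - Complex.I * y) := by
    apply Complex.ext <;> simp
    norm_num
  have hsin : Complex.sin (Real.pi * (1 / 2 - Complex.I * y)) = Complex.cosh (Real.pi * y) := by
    rw [← Complex.cos_mul_I, ← Complex.sin_pi_div_two_sub]; ring_nf
  rw [← Complex.ofReal_inj]
  push_cast
  rw [← Complex.mul_conj', ← Complex.Gamma_conj, ← hconj, h, hsin]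

/-! ### Asymptotics on the ray `e ^ (-i π / 4) s` -/

theorem eighthInv_eq : eighthInv = (√2 / 2 : ℝ) - (√2 / 2 : ℝ) * Complex.I := by
  rw [eighthInv, mul_comm, ← neg_mul, ← Complex.ofReal_neg, Complex.exp_mul_I,
    ← Complex.ofReal_cos, ← Complex.ofReal_sin, Real.cos_neg, Real.sin_neg, Real.cos_pi_div_four,
    Real.sin_pi_div_four]
  push_cast
  ring

theorem eighthInv_sq : eighthInv ^ 2 = -Complex.I := by
  have h : (√2 : ℂ) ^ 2 = 2 := by exact_mod_cast Real.sq_sqrt (zero_le_two)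
  rw [eighthInv_eq]
  push_cast
  linear_combination ((1 - Complex.I) ^ 2 / 4) * h + (1 / 2) * Complex.I_sq

theorem norm_eighthInv : ‖eighthInv‖ = 1 := by
  rw [eighthInv, Complex.norm_exp]; simp

theorem norm_eighth : ‖eighth‖ = 1 := by
  rw [eighth, Complex.norm_exp]; simp

theorem conj_eighth : conj eighth = eighthInv := by
  rw [eighth, eighthInv, ← Complex.exp_conj]
  simp only [map_mul, Complex.conj_I, Complex.conj_ofReal, neg_mul]

theorem eighthInv_mul_re (s : ℝ) : (eighthInv * s).re = √2 / 2 * s := by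
  rw [eighthInv_eq, Complex.re_mul_ofReal]
  simp

theorem eighthInv_mul_cpow (μ : ℝ) {s : ℝ} (hs : 0 < s) :
    (eighthInv * s) ^ (Complex.I * μ) =
      Complex.exp ((Real.pi * μ / 4 : ℝ)) * Complex.exp ((μ * Real.log s : ℝ) * Complex.I) := by
  have h : eighthInv * s = s * Complex.exp ((-(Real.pi / 4) : ℝ) * Complex.I) := by
    rw [eighthInv, mul_comm]; congr 2; push_cast; ring
  have hne : eighthInv * s ≠ 0 := by
    rw [h]; exact mul_ne_zero (Complex.ofReal_ne_zero.2 hs.ne') (Complex.exp_ne_zero _)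
  have hpi := Real.pi_pos
  rw [Complex.cpow_def_of_ne_zero hne, ← Complex.exp_add, h, Complex.log_ofReal_mul hs
    (Complex.exp_ne_zero _), Complex.log_exp (by simp; linarith) (by simp; linarith)]
  congr 1
  push_cast
  linear_combination (-(Real.pi : ℂ) * μ / 4) * Complex.I_sq

theorem norm_eighthInv_mul_cpow (μ : ℝ) {s : ℝ} (hs : 0 < s) :
    ‖(eighthInv * s) ^ (Complex.I * μ)‖ = Real.exp (Real.pi * μ / 4) := by
  rw [eighthInv_mul_cpow μ hs, norm_mul, Complex.norm_exp_ofReal_mul_I, mul_one,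
    Complex.norm_exp_ofReal]

theorem moment_sub_isBigO {c : ℂ} (hc : 0 ≤ c.re) :
    (fun s : ℝ => moment c (eighthInv * s) -
      (eighthInv * s) ^ (-(c + 1)) * Complex.Gamma (c + 1)) =O[atTop] fun s : ℝ => s⁻¹ ^ 2 := by
  refine IsBigO.of_bound (2 * Real.Gamma (c.re + 3)) ?_
  filter_upwards [eventually_ge_atTop 2] with s hs
  have h2 : 0 < √2 := by positivity
  have h2' : 1 ≤ √2 := Real.one_le_sqrt.2 one_le_two
  have hre := eighthInv_mul_re s
  have hpos : 0 < (eighthInv * s).re := by rw [hre]; positivity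
  have hone : 1 ≤ (eighthInv * s).re := by rw [hre]; nlinarith
  refine (norm_moment_sub_le (by linarith) hpos).trans ?_
  have hG : 0 ≤ Real.Gamma (c.re + 3) := (Real.Gamma_pos_of_pos (by linarith)).le
  rw [mul_right_comm]
  gcongr
  calc (1 / (eighthInv * s).re) ^ (c.re + 3) ≤ (1 / (eighthInv * s).re) ^ (2 : ℝ) :=
        Real.rpow_le_rpow_of_exponent_ge (by positivity) ((div_le_one hpos).2 hone) (by linarith)
    _ = 2 * ‖s⁻¹ ^ 2‖ := by
        rw [Real.rpow_ofNat, hre, Real.norm_of_nonneg (by positivity)]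
        have : √2 ^ 2 = 2 := Real.sq_sqrt zero_le_two
        field_simp
        rw [this]

theorem ray_mul_moment_sub_isBigO (μ : ℝ) :
    (fun s : ℝ => eighthInv * s * moment (-(Complex.I * μ)) (eighthInv * s) -
      (eighthInv * s) ^ (Complex.I * μ) * Complex.Gamma (1 - Complex.I * μ))
      =O[atTop] fun s : ℝ => s⁻¹ := by
  have h := moment_sub_isBigO (c := -(Complex.I * μ)) (by simp)
  have h1 : (fun s : ℝ => eighthInv * s) =O[atTop] fun s : ℝ => s := by
    refine IsBigO.of_bound 1 (.of_forall fun s => ?_)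
    rw [norm_mul, norm_eighthInv, Complex.norm_real]
  refine ((h1.mul h).congr' ?_ ?_)
  · filter_upwards [eventually_gt_atTop 0] with s hs
    have hne : eighthInv * s ≠ 0 :=
      mul_ne_zero (Complex.exp_ne_zero _) (Complex.ofReal_ne_zero.2 hs.ne')
    rw [show -(-(Complex.I * (μ : ℂ)) + 1) = Complex.I * μ - 1 by ring,
      Complex.cpow_sub _ _ hne, Complex.cpow_one,
      show -(Complex.I * (μ : ℂ)) + 1 = 1 - Complex.I * μ by ring, mul_sub, div_mul_eq_mul_div,
      mul_div_cancel₀ _ hne]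
  · filter_upwards [eventually_gt_atTop 0] with s hs
    field_simp

theorem ray_cpow_isBigO_one (μ : ℝ) :
    (fun s : ℝ => (eighthInv * s) ^ (Complex.I * μ)) =O[atTop] fun _ : ℝ => (1 : ℝ) := by
  refine IsBigO.of_bound (Real.exp (Real.pi * μ / 4)) ?_
  filter_upwards [eventually_gt_atTop 0] with s hs
  rw [norm_eighthInv_mul_cpow μ hs]; simp

theorem inv_isBigO_one : (fun s : ℝ => s⁻¹) =O[atTop] fun _ : ℝ => (1 : ℝ) :=
  tendsto_inv_atTop_zero.isBigO_one ℝ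

theorem ray_inv_isBigO : (fun s : ℝ => (eighthInv * s)⁻¹) =O[atTop] fun s : ℝ => s⁻¹ := by
  refine IsBigO.of_bound 1 (.of_forall fun s => ?_)
  rw [norm_inv, norm_mul, norm_eighthInv, Complex.norm_real, norm_inv, one_mul, one_mul]

theorem moment_ray_isBigO (μ : ℝ) :
    (fun s : ℝ => moment (-(Complex.I * μ)) (eighthInv * s)) =O[atTop] fun s : ℝ => s⁻¹ := by
  have h1 := (ray_mul_moment_sub_isBigO μ).trans inv_isBigO_one
  have h2 := (ray_cpow_isBigO_one μ).mul (isBigO_const_const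
    (Complex.Gamma (1 - Complex.I * μ)) (one_ne_zero (α := ℝ)) atTop)
  simp only [mul_one] at h2
  have h3 := ray_inv_isBigO.mul (h1.add h2)
  refine h3.congr' ?_ (.of_forall fun s => mul_one _)
  filter_upwards [eventually_gt_atTop 0] with s hs
  have hne : eighthInv * s ≠ 0 :=
    mul_ne_zero (Complex.exp_ne_zero _) (Complex.ofReal_ne_zero.2 hs.ne')
  rw [sub_add_cancel, inv_mul_cancel_left₀ hne]

theorem moment_add_one_ray_isBigO (μ : ℝ) :
    (fun s : ℝ => moment (-(Complex.I * μ) + 1) (eighthInv * s)) =O[atTop] fun s : ℝ => s⁻¹ := by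
  have hsq : (fun s : ℝ => s⁻¹ ^ 2) =O[atTop] fun s : ℝ => s⁻¹ := by
    simpa [pow_two] using (isBigO_refl (fun s : ℝ => s⁻¹) atTop).mul inv_isBigO_one
  have h := (moment_sub_isBigO (c := -(Complex.I * μ) + 1) (by simp)).trans hsq
  have h2 : (fun s : ℝ => (eighthInv * s) ^ (-(-(Complex.I * μ) + 1 + 1)) *
      Complex.Gamma (-(Complex.I * μ) + 1 + 1)) =O[atTop] fun s : ℝ => s⁻¹ := by
    have h3 := ((ray_cpow_isBigO_one μ).mul (ray_inv_isBigO.pow 2)).mul (isBigO_const_const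
      (Complex.Gamma (-(Complex.I * μ) + 1 + 1)) (one_ne_zero (α := ℝ)) atTop)
    refine (h3.congr' ?_ (.of_forall fun s => ?_)).trans hsq
    · filter_upwards [eventually_gt_atTop 0] with s hs
      have hne : eighthInv * s ≠ 0 :=
        mul_ne_zero (Complex.exp_ne_zero _) (Complex.ofReal_ne_zero.2 hs.ne')
      rw [show -(-(Complex.I * (μ : ℂ)) + 1 + 1) = Complex.I * μ - 2 by ring,
        Complex.cpow_sub _ _ hne, Complex.cpow_ofNat, inv_pow, div_eq_mul_inv]
    · simp
  simpa using h.add h2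

/-! ### The Landau-Zener system -/

/-- `(a, b)` solves the Landau-Zener system `-i ∂_s (a, b) = ½ [[s, z], [z̄, -s]] (a, b)`. -/
structure IsTwoLevel (z : ℂ) (a b : ℝ → ℂ) : Prop where
  fst : ∀ s : ℝ, HasDerivAt a (Complex.I / 2 * (s * a s + z * b s)) s
  snd : ∀ s : ℝ, HasDerivAt b (Complex.I / 2 * (conj z * a s - s * b s)) s

theorem IsTwoLevel.const_mul {z : ℂ} {a b : ℝ → ℂ} (h : IsTwoLevel z a b) (k : ℂ) :
    IsTwoLevel z (fun s => k * a s) (fun s => k * b s) where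
  fst s := by convert! (h.fst s).const_mul k using 1; ring
  snd s := by convert! (h.snd s).const_mul k using 1; ring

/-- The norm of a solution is conserved, as the matrix of the system is Hermitian. -/
theorem IsTwoLevel.norm_sq_eq {z : ℂ} {a b : ℝ → ℂ} (h : IsTwoLevel z a b) (s : ℝ) :
    ‖a s‖ ^ 2 + ‖b s‖ ^ 2 = ‖a 0‖ ^ 2 + ‖b 0‖ ^ 2 := by
  have hd : ∀ s : ℝ, HasDerivAt (fun s => a s * conj (a s) + b s * conj (b s)) 0 s := fun s => by
    have ha : HasDerivAt (fun s => conj (a s)) _ s := (h.fst s).star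
    have hb : HasDerivAt (fun s => conj (b s)) _ s := (h.snd s).star
    convert! ((h.fst s).mul ha).add ((h.snd s).mul hb) using 1
    simp only [Complex.star_def, map_mul, map_add, map_sub, map_div₀, Complex.conj_I,
      Complex.conj_ofReal, Complex.conj_conj, map_ofNat]
    ring
  have := is_const_of_deriv_eq_zero (fun s => (hd s).differentiableAt) (fun s => (hd s).deriv) s 0
  simp only [Complex.mul_conj'] at this
  exact_mod_cast this

/-- The phase `e ^ (i (s² / 4 + (|z|² / 4) ln |s|))` of the upper level of the Landau-Zener system;
its square is the phase of the `+` component of the three level system. -/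
noncomputable def halfOsc (z : ℂ) (s : ℝ) : ℂ :=
  Complex.exp ((s ^ 2 / 4 + ‖z‖ ^ 2 / 4 * Real.log s : ℝ) * Complex.I)

theorem norm_halfOsc (z : ℂ) (s : ℝ) : ‖halfOsc z s‖ = 1 := Complex.norm_exp_ofReal_mul_I _

/-- Lower component of the solution of the Landau-Zener system that is purely in the upper level at
`+∞`. -/
noncomputable def lowerSol (z : ℂ) (s : ℝ) : ℂ :=
  Complex.exp (Complex.I * s ^ 2 / 4) *
    moment (-(Complex.I * (‖z‖ ^ 2 / 4 : ℝ))) (eighthInv * s)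

/-- Upper component of the solution of the Landau-Zener system that is purely in the upper level at
`+∞`; the equation of the lower component determines it from `lowerSol`. -/
noncomputable def upperSol (z : ℂ) (s : ℝ) : ℂ :=
  2 * Complex.I * eighthInv / conj z * Complex.exp (Complex.I * s ^ 2 / 4) *
    (moment (-(Complex.I * (‖z‖ ^ 2 / 4 : ℝ)) + 1) (eighthInv * s) +
      eighthInv * s * moment (-(Complex.I * (‖z‖ ^ 2 / 4 : ℝ))) (eighthInv * s))

/-- The amplitude of `upperSol` at `+∞` relative to the phase `halfOsc`. -/
noncomputable def upperLimit (z : ℂ) : ℂ :=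
  2 * Complex.I * eighthInv / conj z * Complex.exp ((Real.pi * (‖z‖ ^ 2 / 4) / 4 : ℝ)) *
    Complex.Gamma (1 - Complex.I * (‖z‖ ^ 2 / 4 : ℝ))

theorem neg_I_mul_re (x : ℝ) : (-(Complex.I * x)).re = 0 := by simp

theorem norm_sq_eq_mul_conj (z : ℂ) : ((‖z‖ ^ 2 / 4 : ℝ) : ℂ) = z * conj z / 4 := by
  rw [Complex.mul_conj']; push_cast; rfl

theorem isTwoLevel_sol {z : ℂ} (hz : z ≠ 0) : IsTwoLevel z (upperSol z) (lowerSol z) := by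
  have hzc : conj z ≠ 0 := (map_ne_zero _).2 hz
  set c : ℂ := -(Complex.I * (‖z‖ ^ 2 / 4 : ℝ)) with hc
  have hre : c.re = 0 := by rw [hc, neg_I_mul_re]
  have hray (s : ℝ) : HasDerivAt (fun s : ℝ => eighthInv * (s : ℂ)) eighthInv s := by
    simpa using (hasDerivAt_id (s : ℂ)).comp_ofReal.const_mul eighthInv
  have hexp (s : ℝ) : HasDerivAt (fun s : ℝ => Complex.exp (Complex.I * s ^ 2 / 4))
      (Complex.exp (Complex.I * s ^ 2 / 4) * (Complex.I * s / 2)) s := by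
    have h := (((hasDerivAt_id (s : ℂ)).pow 2).const_mul Complex.I).div_const 4
    convert! h.cexp.comp_ofReal using 1
    simp
    ring
  have h0 (s : ℝ) : HasDerivAt (fun s : ℝ => moment c (eighthInv * s)) _ s :=
    (hasDerivAt_moment (by rw [hre]; norm_num) _).comp s (hray s)
  have h1 (s : ℝ) : HasDerivAt (fun s : ℝ => moment (c + 1) (eighthInv * s)) _ s :=
    (hasDerivAt_moment (by rw [Complex.add_re, hre]; norm_num) _).comp s (hray s)
  have hrec (s : ℝ) := moment_add_two (c := c) (by rw [hre]; norm_num) (eighthInv * s)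
  have hk := eighthInv_sq
  set K : ℂ := 2 * Complex.I * eighthInv / conj z with hKdef
  have hK : K * conj z = 2 * Complex.I * eighthInv := div_mul_cancel₀ _ hzc
  constructor <;> intro s
  · convert! ((hexp s).const_mul K).mul
      ((h1 s).add ((hray s).mul (h0 s))) using 1
    have hr := hrec s
    rw [show c + 2 = c + 1 + 1 by ring] at hr
    simp only [upperSol, lowerSol, ← hc, Pi.add_apply, Pi.mul_apply]
    rw [norm_sq_eq_mul_conj] at hc
    linear_combination
      K * Complex.exp (Complex.I * s ^ 2 / 4) * eighthInv * hr +
      K * Complex.exp (Complex.I * s ^ 2 / 4) * eighthInv * moment c (eighthInv * s) * hc -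
      Complex.exp (Complex.I * s ^ 2 / 4) * eighthInv * moment c (eighthInv * s) *
        Complex.I * z / 4 * hK -
      Complex.I ^ 2 / 2 * z * Complex.exp (Complex.I * s ^ 2 / 4) *
        moment c (eighthInv * s) * hk +
      Complex.I / 2 * z * Complex.exp (Complex.I * s ^ 2 / 4) *
        moment c (eighthInv * s) * Complex.I_sq
  · convert! (hexp s).mul (h0 s) using 1
    simp only [upperSol, lowerSol, ← hc]
    linear_combination
      Complex.I / 2 * Complex.exp (Complex.I * s ^ 2 / 4) *
        (moment (c + 1) (eighthInv * s) + eighthInv * s * moment c (eighthInv * s)) * hK +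
      (eighthInv * Complex.exp (Complex.I * s ^ 2 / 4) * moment (c + 1) (eighthInv * s) +
        eighthInv ^ 2 * s * Complex.exp (Complex.I * s ^ 2 / 4) * moment c (eighthInv * s)) *
        Complex.I_sq -
      s * Complex.exp (Complex.I * s ^ 2 / 4) * moment c (eighthInv * s) * hk

theorem lowerSol_isBigO (z : ℂ) : lowerSol z =O[atTop] fun s : ℝ => s⁻¹ := by
  have h : (fun s : ℝ => Complex.exp (Complex.I * s ^ 2 / 4)) =O[atTop] fun _ : ℝ => (1 : ℝ) := by
    refine IsBigO.of_bound 1 (.of_forall fun s => ?_)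
    rw [show Complex.I * (s : ℂ) ^ 2 / 4 = ((s ^ 2 / 4 : ℝ) : ℂ) * Complex.I by push_cast; ring,
      Complex.norm_exp_ofReal_mul_I]
    simp
  exact (h.mul (moment_ray_isBigO (‖z‖ ^ 2 / 4))).congr_right fun s => one_mul _

theorem upperSol_sub_isBigO (z : ℂ) :
    (fun s : ℝ => upperSol z s - upperLimit z * halfOsc z s) =O[atTop] fun s : ℝ => s⁻¹ := by
  have h : (fun s : ℝ => 2 * Complex.I * eighthInv / conj z *
      Complex.exp (Complex.I * s ^ 2 / 4)) =O[atTop] fun _ : ℝ => (1 : ℝ) := by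
    refine IsBigO.of_bound ‖2 * Complex.I * eighthInv / conj z‖ (.of_forall fun s => ?_)
    rw [show Complex.I * (s : ℂ) ^ 2 / 4 = ((s ^ 2 / 4 : ℝ) : ℂ) * Complex.I by push_cast; ring,
      norm_mul, Complex.norm_exp_ofReal_mul_I]
    simp
  have h1 := h.mul ((moment_add_one_ray_isBigO (‖z‖ ^ 2 / 4)).add (ray_mul_moment_sub_isBigO (‖z‖ ^ 2 / 4)))
  refine h1.congr' ?_ (.of_forall fun s => one_mul _)
  filter_upwards [eventually_gt_atTop 0] with s hs
  have hosc : halfOsc z s = Complex.exp (Complex.I * s ^ 2 / 4) *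
      Complex.exp ((‖z‖ ^ 2 / 4 * Real.log s : ℝ) * Complex.I) := by
    rw [halfOsc, ← Complex.exp_add]; congr 1; push_cast; ring
  rw [upperSol, upperLimit, hosc, eighthInv_mul_cpow _ hs]
  ring

/-- Conservation of the norm, between `0` and `+∞`. -/
theorem norm_upperLimit_sq {z : ℂ} (hz : z ≠ 0) :
    ‖upperLimit z‖ ^ 2 = ‖upperSol z 0‖ ^ 2 + ‖lowerSol z 0‖ ^ 2 := by
  have hl : Tendsto (fun s => ‖lowerSol z s‖) atTop (𝓝 0) :=
    tendsto_zero_iff_norm_tendsto_zero.1 ((lowerSol_isBigO z).trans_tendsto tendsto_inv_atTop_zero)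
  have hu : Tendsto (fun s => ‖upperSol z s‖) atTop (𝓝 ‖upperLimit z‖) := by
    have h1 := (upperSol_sub_isBigO z).trans_tendsto tendsto_inv_atTop_zero
    rw [tendsto_iff_norm_sub_tendsto_zero]
    refine squeeze_zero (fun s => norm_nonneg _) (fun s => ?_)
      (tendsto_zero_iff_norm_tendsto_zero.1 h1)
    have : ‖upperLimit z‖ = ‖upperLimit z * halfOsc z s‖ := by
      rw [norm_mul, norm_halfOsc, mul_one]
    rw [this]
    exact abs_norm_sub_norm_le _ _
  have h := (hu.pow 2).add (hl.pow 2)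
  simp only [(isTwoLevel_sol hz).norm_sq_eq] at h
  have := tendsto_nhds_unique h tendsto_const_nhds
  rw [← this]; ring

theorem lowerSol_zero (z : ℂ) :
    lowerSol z 0 = (2 : ℝ) ^ (-(Complex.I * (‖z‖ ^ 2 / 8 : ℝ)) - 1 / 2) *
      Complex.Gamma (1 / 2 - Complex.I * (‖z‖ ^ 2 / 8 : ℝ)) := by
  rw [lowerSol, Complex.ofReal_zero, mul_zero, moment_zero (by rw [neg_I_mul_re]; norm_num)]
  push_cast
  rw [show Complex.I * 0 ^ 2 / 4 = 0 by ring, Complex.exp_zero, one_mul]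
  ring_nf

theorem upperSol_zero (z : ℂ) :
    upperSol z 0 = 2 * Complex.I * eighthInv / conj z *
      ((2 : ℝ) ^ (-(Complex.I * (‖z‖ ^ 2 / 8 : ℝ))) *
      Complex.Gamma (1 - Complex.I * (‖z‖ ^ 2 / 8 : ℝ))) := by
  rw [upperSol, Complex.ofReal_zero, mul_zero, moment_zero (by
    rw [Complex.add_re, neg_I_mul_re]; norm_num)]
  push_cast
  rw [show Complex.I * 0 ^ 2 / 4 = 0 by ring, Complex.exp_zero]
  ring_nf

theorem norm_lowerSol_zero_sq (z : ℂ) :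
    ‖lowerSol z 0‖ ^ 2 = Real.pi / 2 / Real.cosh (Real.pi * (‖z‖ ^ 2 / 8)) := by
  rw [lowerSol_zero, norm_mul, mul_pow, norm_Gamma_half_sub_sq,
    Complex.norm_cpow_eq_rpow_re_of_pos two_pos, Complex.sub_re, neg_I_mul_re, ← Real.rpow_natCast,
    ← Real.rpow_mul zero_le_two]
  norm_num
  ring

theorem norm_upperSol_zero_sq {z : ℂ} (hz : z ≠ 0) :
    ‖upperSol z 0‖ ^ 2 = Real.pi / 2 / Real.sinh (Real.pi * (‖z‖ ^ 2 / 8)) := by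
  have hz' : ‖z‖ ≠ 0 := norm_ne_zero_iff.2 hz
  rw [upperSol_zero, norm_mul, norm_mul, mul_pow, mul_pow, norm_Gamma_one_sub_sq (by positivity),
    Complex.norm_cpow_eq_rpow_re_of_pos two_pos, neg_I_mul_re, Real.rpow_zero, norm_div, norm_mul,
    norm_mul, Complex.norm_I, norm_eighthInv, RCLike.norm_conj, Complex.norm_ofNat]
  field_simp
  norm_num

/-- The duplication formula merges the two Gamma values at `s = 0` into the single one that occurs
in the amplitude at `+∞`. -/
theorem upperSol_mul_lowerSol_zero (z : ℂ) :
    upperSol z 0 * lowerSol z 0 = 2 * Complex.I * eighthInv / conj z * √(Real.pi / 2) *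
      Complex.Gamma (1 - Complex.I * (‖z‖ ^ 2 / 4 : ℝ)) := by
  have h := Complex.Gamma_mul_Gamma_add_half (1 / 2 - Complex.I * (‖z‖ ^ 2 / 8 : ℝ))
  rw [show 1 / 2 - Complex.I * (‖z‖ ^ 2 / 8 : ℝ) + 1 / 2 =
      1 - Complex.I * (‖z‖ ^ 2 / 8 : ℝ) by ring,
    show 2 * (1 / 2 - Complex.I * (‖z‖ ^ 2 / 8 : ℝ)) = 1 - Complex.I * (‖z‖ ^ 2 / 4 : ℝ) by
      push_cast; ring,
    show 1 - (1 - Complex.I * (‖z‖ ^ 2 / 4 : ℝ)) = Complex.I * (‖z‖ ^ 2 / 4 : ℝ) by ring] at h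
  have h2 : (2 : ℂ) ^ (-(Complex.I * (‖z‖ ^ 2 / 8 : ℝ))) *
      (2 : ℂ) ^ (-(Complex.I * (‖z‖ ^ 2 / 8 : ℝ)) - 1 / 2) *
      (2 : ℂ) ^ (Complex.I * (‖z‖ ^ 2 / 4 : ℝ)) = (2 : ℂ) ^ (-(1 / 2 : ℂ)) := by
    rw [← Complex.cpow_add _ _ two_ne_zero, ← Complex.cpow_add _ _ two_ne_zero]
    congr 1
    push_cast
    ring
  have h3 : (√(Real.pi / 2) : ℂ) = (2 : ℂ) ^ (-(1 / 2 : ℂ)) * √Real.pi := by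
    rw [Real.sqrt_div Real.pi_pos.le, Real.sqrt_eq_rpow 2, Complex.cpow_neg]
    push_cast
    rw [Complex.ofReal_cpow zero_le_two]
    push_cast
    ring
  rw [upperSol_zero, lowerSol_zero, h3, ← h2, Complex.ofReal_ofNat]
  linear_combination 2 * Complex.I * eighthInv / conj z *
    (2 : ℂ) ^ (-(Complex.I * (‖z‖ ^ 2 / 8 : ℝ))) *
      (2 : ℂ) ^ (-(Complex.I * (‖z‖ ^ 2 / 8 : ℝ)) - 1 / 2) * h

theorem Gamma_one_sub_ne_zero (x : ℝ) : Complex.Gamma (1 - Complex.I * x) ≠ 0 :=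
  Complex.Gamma_ne_zero_of_re_pos (by simp)

theorem norm_Omega {z : ℂ} (hz : z ≠ 0) : ‖Ω z‖ = 1 := by
  have hG : Complex.Gamma (1 - Complex.I * (‖z‖ ^ 2 / 4 : ℝ)) ≠ 0 := Gamma_one_sub_ne_zero _
  rw [Ω, norm_mul, norm_div, norm_div, Complex.norm_real, Complex.norm_real, norm_norm, norm_norm,
    div_self (norm_ne_zero_iff.2 hz), div_self (norm_ne_zero_iff.2 hG), mul_one]

/-- The off-diagonal entry of the Landau-Zener scattering matrix has the phase
`e ^ (i π / 4) Ω z`. -/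
theorem upperLimit_sq_mul_conj {z : ℂ} (hz : z ≠ 0) :
    ∃ R : ℝ, 0 ≤ R ∧
      2 * upperLimit z ^ 2 * conj (upperSol z 0 * lowerSol z 0) = R * (eighth * Ω z) := by
  set G := Complex.Gamma (1 - Complex.I * (‖z‖ ^ 2 / 4 : ℝ)) with hGdef
  have hG : ‖G‖ ≠ 0 := norm_ne_zero_iff.2 (Gamma_one_sub_ne_zero _)
  have hz0 : ‖z‖ ≠ 0 := norm_ne_zero_iff.2 hz
  have hzc : conj z ≠ 0 := (map_ne_zero _).2 hz
  set E : ℝ := Real.exp (Real.pi * (‖z‖ ^ 2 / 4) / 4) with hE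
  refine ⟨16 * E ^ 2 * √(Real.pi / 2) * ‖G‖ ^ 3 / ‖z‖ ^ 3, by positivity, ?_⟩
  have hk : eighthInv ^ 2 = -Complex.I := eighthInv_sq
  have hkc : conj eighthInv = eighth := by rw [← conj_eighth, Complex.conj_conj]
  have hGG := Complex.mul_conj' G
  have hzz := Complex.mul_conj' z
  have hG' : (‖G‖ : ℂ) ≠ 0 := Complex.ofReal_ne_zero.2 hG
  have hz' : (‖z‖ : ℂ) ≠ 0 := Complex.ofReal_ne_zero.2 hz0
  rw [upperSol_mul_lowerSol_zero, upperLimit, Ω, ← hGdef, ← Complex.ofReal_exp, ← hE]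
  simp only [map_mul, map_div₀, Complex.conj_I, Complex.conj_conj, hkc, Complex.conj_ofReal,
    map_ofNat]
  push_cast
  calc _ = 16 * (-Complex.I ^ 3) * eighthInv ^ 2 * (E : ℂ) ^ 2 * √(Real.pi / 2) * eighth * G *
        (G * conj G) * z / (z * conj z) ^ 2 := by field_simp; ring
    _ = _ := by
      rw [hk, hGG, hzz]
      field_simp
      rw [Complex.I_pow_four, one_mul]

/-- The Landau-Zener system has a solution of norm one that is purely in the upper level at `+∞`,
and whose values at `0` give the entries `e ^ (-π |z|² / 4)` and
`e ^ (i π / 4) Ω z √(1 - e ^ (-π |z|² / 2))` of the two level scattering matrix. -/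
theorem exists_normalized_twoLevel {z : ℂ} (hz : z ≠ 0) :
    ∃ (a b : ℝ → ℂ) (η : ℂ), IsTwoLevel z a b ∧ (∀ s, ‖a s‖ ^ 2 + ‖b s‖ ^ 2 = 1) ∧ ‖η‖ = 1 ∧
      ((fun s => a s - η * halfOsc z s) =O[atTop] fun s : ℝ => s⁻¹) ∧
      (b =O[atTop] fun s : ℝ => s⁻¹) ∧
      ‖a 0‖ ^ 2 - ‖b 0‖ ^ 2 = Real.exp (-Real.pi * ‖z‖ ^ 2 / 4) ∧
      2 * η ^ 2 * conj (a 0 * b 0) = eighth * Ω z * (√(1 - decay z) : ℝ) := by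
  have hz0 : ‖z‖ ≠ 0 := norm_ne_zero_iff.2 hz
  set x : ℝ := Real.pi * (‖z‖ ^ 2 / 8) with hx
  have hxpos : 0 < x := by positivity
  have hsh : 0 < Real.sinh x := Real.sinh_pos_iff.2 hxpos
  have hch : 0 < Real.cosh x := Real.cosh_pos x
  have hA := norm_upperSol_zero_sq hz
  have hB := norm_lowerSol_zero_sq z
  rw [← hx] at hA hB
  have hN := norm_upperLimit_sq hz
  -- By `norm_upperLimit_sq`, this is the constant norm of the solution.
  set N : ℝ := ‖upperLimit z‖ with hNdef
  have hN2 : 0 < N ^ 2 := by rw [hN, hA, hB]; positivity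
  have hNpos : 0 < N := lt_of_le_of_ne (norm_nonneg _) (fun h => by simp [← h] at hN2)
  set k : ℂ := ((N⁻¹ : ℝ) : ℂ) with hk
  have hknorm : ‖k‖ = N⁻¹ := by rw [hk, Complex.norm_real, Real.norm_of_nonneg (by positivity)]
  have hsol := (isTwoLevel_sol hz).const_mul k
  have hnorm (s : ℝ) : ‖k * upperSol z s‖ ^ 2 + ‖k * lowerSol z s‖ ^ 2 = 1 := by
    rw [hsol.norm_sq_eq s, norm_mul, norm_mul, mul_pow, mul_pow, ← mul_add, ← hN, hknorm]
    field_simp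
  have hη : ‖k * upperLimit z‖ = 1 := by rw [norm_mul, hknorm, ← hNdef]; field_simp
  have hdiff : ‖k * upperSol z 0‖ ^ 2 - ‖k * lowerSol z 0‖ ^ 2 =
      Real.exp (-Real.pi * ‖z‖ ^ 2 / 4) := by
    have h1 : -Real.pi * ‖z‖ ^ 2 / 4 = -x - x := by rw [hx]; ring
    rw [norm_mul, norm_mul, mul_pow, mul_pow, ← mul_sub, hknorm, inv_pow, hN, hA, hB, h1,
      Real.exp_sub, ← Real.cosh_sub_sinh, ← Real.cosh_add_sinh]
    have := Real.pi_pos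
    field_simp
  refine ⟨_, _, k * upperLimit z, hsol, hnorm, hη, ?_, (lowerSol_isBigO z).const_mul_left k,
    hdiff, ?_⟩
  · refine ((upperSol_sub_isBigO z).const_mul_left k).congr_left fun s => by ring
  · obtain ⟨R, hR, hRe⟩ := upperLimit_sq_mul_conj hz
    -- A nonnegative multiple of a number of modulus one: only its modulus is left to compute.
    set t := 2 * (k * upperLimit z) ^ 2 * conj (k * upperSol z 0 * (k * lowerSol z 0)) with ht
    have ht1 : t = ((N⁻¹ ^ 4 * R : ℝ) : ℂ) * (eighth * Ω z) := by
      have hkc : conj k = k := Complex.conj_ofReal _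
      rw [Complex.ofReal_mul, mul_assoc, ← hRe, ht]
      simp only [map_mul, hkc]
      rw [Complex.ofReal_pow, ← hk]
      ring
    have hR' : 0 ≤ N⁻¹ ^ 4 * R := by positivity
    have ht2 : ‖t‖ = N⁻¹ ^ 4 * R := by
      rw [ht1, norm_mul, norm_mul, norm_eighth, norm_Omega hz, Complex.norm_real,
        Real.norm_of_nonneg hR', mul_one, mul_one]
    have ht3 : ‖t‖ = 2 * (‖k * upperSol z 0‖ * ‖k * lowerSol z 0‖) := by
      rw [ht, norm_mul, norm_mul, norm_pow, hη, RCLike.norm_conj, norm_mul (k * upperSol z 0),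
        Complex.norm_ofNat]
      ring
    have hd : decay z = Real.exp (-Real.pi * ‖z‖ ^ 2 / 4) ^ 2 := by
      rw [decay, ← Real.exp_nat_mul]
      congr 1
      push_cast
      ring
    have ht4 : √(1 - decay z) = N⁻¹ ^ 4 * R := by
      rw [← ht2, Real.sqrt_eq_iff_eq_sq _ (norm_nonneg _), ht3, hd, ← hdiff]
      · linear_combination (-1 - ‖k * upperSol z 0‖ ^ 2 - ‖k * lowerSol z 0‖ ^ 2) * hnorm 0
      · have : decay z ≤ 1 := by
          rw [decay, Real.exp_le_one_iff]
          have := Real.pi_pos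
          have : 0 ≤ Real.pi * ‖z‖ ^ 2 := by positivity
          linarith
        linarith
    rw [ht1, ht4]
    ring

/-! ### The pseudo Jahn-Teller system -/

/-- `(x, y, w)` are the components `+`, `-`, `0` of a solution of the pseudo Jahn-Teller system
`-i ∂_s v = V s z v`. -/
structure IsThreeLevel (z : ℂ) (x y w : ℝ → ℂ) : Prop where
  plus : ∀ s : ℝ, HasDerivAt x (Complex.I * (s * x s + z / (√2 : ℝ) * w s)) s
  minus : ∀ s : ℝ, HasDerivAt y (Complex.I * (-s * y s + conj z / (√2 : ℝ) * w s)) s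
  zero : ∀ s : ℝ, HasDerivAt w
    (Complex.I * (conj z / (√2 : ℝ) * x s + z / (√2 : ℝ) * y s)) s

theorem IsSolution.isThreeLevel {z : ℂ} {v : ℝ → Fin 3 → ℂ} (hv : IsSolution z v) :
    IsThreeLevel z (fun s => v s 0) (fun s => v s 1) (fun s => v s 2) := by
  have h (s : ℝ) (j : Fin 3) :
      HasDerivAt (fun s => v s j) (Complex.I * ((V s z).mulVec (v s) j)) s := by
    have h1 := hasDerivAt_pi.1 (hv.1 s).hasDerivAt j
    convert! h1 using 1
    rw [← hv.2 s, Pi.smul_apply, smul_eq_mul]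
    linear_combination (-deriv v s j) * Complex.I_sq
  constructor <;> intro s
  · simpa [V, Matrix.mulVec, dotProduct, Fin.sum_univ_three] using h s 0
  · simpa [V, Matrix.mulVec, dotProduct, Fin.sum_univ_three] using h s 1
  · simpa [V, Matrix.mulVec, dotProduct, Fin.sum_univ_three] using h s 2

/-- Reversing `s` changes the sign of the diagonal of `V` relative to that of its off-diagonal part,
which the sign of the `0` component undoes. -/
theorem IsThreeLevel.reflect {z : ℂ} {x y w : ℝ → ℂ} (h : IsThreeLevel z x y w) :
    IsThreeLevel z (fun s => x (-s)) (fun s => y (-s)) (fun s => -w (-s)) where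
  plus s := by
    convert! (h.plus (-s)).scomp s (hasDerivAt_neg s) using 1
    simp; ring
  minus s := by
    convert! (h.minus (-s)).scomp s (hasDerivAt_neg s) using 1
    simp; ring
  zero s := by
    convert! ((h.zero (-s)).scomp s (hasDerivAt_neg s)).neg using 1
    simp

theorem div_sqrt_two (z : ℂ) : z / (√2 : ℝ) = z * (√2 : ℝ) / 2 := by
  have h : ((√2 : ℝ) : ℂ) ^ 2 = 2 := by exact_mod_cast Real.sq_sqrt zero_le_two
  have h0 : ((√2 : ℝ) : ℂ) ≠ 0 := fun h0 => by simp [h0] at h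
  field_simp
  rw [h]

/-- The symmetric products of the two level solutions `(a, b)` and `(-b̄, ā)`, namely
`(a², b², √2 a b)`, `(b̄², ā², -√2 ā b̄)` and `(-√2 a b̄, √2 ā b, |a|² - |b|²)`,
solve the three level system. As its matrix is Hermitian, their inner products with any solution
are constant. -/
theorem IsThreeLevel.inner_eq {z : ℂ} {x y w a b : ℝ → ℂ} (h : IsThreeLevel z x y w)
    (hab : IsTwoLevel z a b) (s : ℝ) :
    (conj (a s) ^ 2 * x s + conj (b s) ^ 2 * y s + (√2 : ℝ) * conj (a s) * conj (b s) * w s =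
      conj (a 0) ^ 2 * x 0 + conj (b 0) ^ 2 * y 0 + (√2 : ℝ) * conj (a 0) * conj (b 0) * w 0) ∧
    (b s ^ 2 * x s + a s ^ 2 * y s - (√2 : ℝ) * a s * b s * w s =
      b 0 ^ 2 * x 0 + a 0 ^ 2 * y 0 - (√2 : ℝ) * a 0 * b 0 * w 0) ∧
    (-(√2 : ℝ) * conj (a s) * b s * x s + (√2 : ℝ) * a s * conj (b s) * y s +
        (a s * conj (a s) - b s * conj (b s)) * w s =
      -(√2 : ℝ) * conj (a 0) * b 0 * x 0 + (√2 : ℝ) * a 0 * conj (b 0) * y 0 +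
        (a 0 * conj (a 0) - b 0 * conj (b 0)) * w 0) := by
  have hr : ((√2 : ℝ) : ℂ) ^ 2 = 2 := by exact_mod_cast Real.sq_sqrt zero_le_two
  have ha := hab.fst
  have hb := hab.snd
  have hac (s : ℝ) : HasDerivAt (fun s => conj (a s))
      (-Complex.I / 2 * (s * conj (a s) + conj z * conj (b s))) s := by
    convert! (ha s).star using 1
    simp
  have hbc (s : ℝ) : HasDerivAt (fun s => conj (b s))
      (-Complex.I / 2 * (z * conj (a s) - s * conj (b s))) s := by
    convert! (hb s).star using 1
    simp
  have hx := h.plus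
  have hy := h.minus
  have hw := h.zero
  simp only [div_sqrt_two] at hx hy hw
  set r : ℂ := ((√2 : ℝ) : ℂ)
  refine ⟨?_, ?_, ?_⟩
  · have hd (s : ℝ) : HasDerivAt (fun s => conj (a s) ^ 2 * x s + conj (b s) ^ 2 * y s +
        r * conj (a s) * conj (b s) * w s) 0 s := by
      convert! ((((hac s).pow 2).mul (hx s)).add (((hbc s).pow 2).mul (hy s))).add
        ((((hac s).const_mul r).mul (hbc s)).mul (hw s)) using 1
      simp
      linear_combination -(conj (a s) * conj (b s) * Complex.I * (conj z * x s + z * y s) / 2) * hr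
    exact is_const_of_deriv_eq_zero (fun s => (hd s).differentiableAt) (fun s => (hd s).deriv) s 0
  · have hd (s : ℝ) : HasDerivAt (fun s => b s ^ 2 * x s + a s ^ 2 * y s -
        r * a s * b s * w s) 0 s := by
      convert! ((((hb s).pow 2).mul (hx s)).add (((ha s).pow 2).mul (hy s))).sub
        ((((ha s).const_mul r).mul (hb s)).mul (hw s)) using 1
      simp
      linear_combination (a s * b s * Complex.I * (conj z * x s + z * y s) / 2) * hr
    exact is_const_of_deriv_eq_zero (fun s => (hd s).differentiableAt) (fun s => (hd s).deriv) s 0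
  · have hd (s : ℝ) : HasDerivAt (fun s => -r * conj (a s) * b s * x s +
        r * a s * conj (b s) * y s + (a s * conj (a s) - b s * conj (b s)) * w s) 0 s := by
      convert! (((((hac s).const_mul (-r)).mul (hb s)).mul (hx s)).add
        ((((ha s).const_mul r).mul (hbc s)).mul (hy s))).add
        ((((ha s).mul (hac s)).sub ((hb s).mul (hbc s))).mul (hw s)) using 1
      simp
      linear_combination (Complex.I * w s / 2 * (conj (a s) * b s * z - a s * conj (b s) *
      conj z)) * hr
    exact is_const_of_deriv_eq_zero (fun s => (hd s).differentiableAt) (fun s => (hd s).deriv) s 0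

theorem osc_plus (z : ℂ) (s : ℝ) : osc z 0 s = halfOsc z s ^ 2 := by
  rw [osc, halfOsc, ← Complex.exp_nat_mul, Real.log_abs]
  congr 1
  simp [mode]
  ring

theorem osc_minus (z : ℂ) (s : ℝ) : osc z 1 s = conj (halfOsc z s) ^ 2 := by
  rw [osc, halfOsc, ← Complex.exp_conj, ← Complex.exp_nat_mul, Real.log_abs]
  congr 1
  rw [map_mul, Complex.conj_ofReal, Complex.conj_I]
  simp [mode]
  ring

theorem osc_zero (z : ℂ) (s : ℝ) : osc z 2 s = 1 := by
  simp [osc, mode]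

theorem osc_neg (z : ℂ) (ℓ : Fin 3) (s : ℝ) : osc z ℓ (-s) = osc z ℓ s := by
  rw [osc, osc, neg_sq, abs_neg]

/-- Asymptotics of a three level solution at `+∞`. When `|a|² + |b|² = 1` the three symmetric
products of `inner_eq` are orthonormal, so the solution is their combination with the constant inner
products as coefficients; each of them is asymptotically a multiple of one basis vector, because `b`
tends to `0`. -/
theorem IsThreeLevel.isBigO {z η : ℂ} {x y w a b : ℝ → ℂ} (h : IsThreeLevel z x y w)
    (hab : IsTwoLevel z a b) (hnorm : ∀ s, ‖a s‖ ^ 2 + ‖b s‖ ^ 2 = 1)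
    (ha : (fun s => a s - η * halfOsc z s) =O[atTop] fun s : ℝ => s⁻¹)
    (hb : b =O[atTop] fun s : ℝ => s⁻¹) :
    ((fun s => x s - osc z 0 s * (η ^ 2 * (conj (a 0) ^ 2 * x 0 + conj (b 0) ^ 2 * y 0 +
      (√2 : ℝ) * conj (a 0) * conj (b 0) * w 0))) =O[atTop] fun s : ℝ => s⁻¹) ∧
    ((fun s => y s - osc z 1 s * (conj η ^ 2 * (b 0 ^ 2 * x 0 + a 0 ^ 2 * y 0 -
      (√2 : ℝ) * a 0 * b 0 * w 0))) =O[atTop] fun s : ℝ => s⁻¹) ∧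
    ((fun s => w s - osc z 2 s * (-(√2 : ℝ) * conj (a 0) * b 0 * x 0 +
      (√2 : ℝ) * a 0 * conj (b 0) * y 0 + (a 0 * conj (a 0) - b 0 * conj (b 0)) * w 0))
      =O[atTop] fun s : ℝ => s⁻¹) := by
  have hr : ((√2 : ℝ) : ℂ) ^ 2 = 2 := by exact_mod_cast Real.sq_sqrt zero_le_two
  have hn (s : ℝ) : a s * conj (a s) + b s * conj (b s) = 1 := by
    rw [Complex.mul_conj', Complex.mul_conj']; exact_mod_cast hnorm s
  have hc := h.inner_eq hab
  set r : ℂ := ((√2 : ℝ) : ℂ)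
  set c₀ := conj (a 0) ^ 2 * x 0 + conj (b 0) ^ 2 * y 0 + r * conj (a 0) * conj (b 0) * w 0
  set c₁ := b 0 ^ 2 * x 0 + a 0 ^ 2 * y 0 - r * a 0 * b 0 * w 0
  set c₂ := -r * conj (a 0) * b 0 * x 0 + r * a 0 * conj (b 0) * y 0 +
    (a 0 * conj (a 0) - b 0 * conj (b 0)) * w 0
  have conjO {f : ℝ → ℂ} {g : ℝ → ℝ} (hf : f =O[atTop] g) : (fun s => conj (f s)) =O[atTop] g :=
    hf.norm_left.congr_left (fun s => (RCLike.norm_conj (f s)).symm) |>.of_norm_left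
  have ha1 : a =O[atTop] fun _ : ℝ => (1 : ℝ) := by
    refine IsBigO.of_bound 1 (.of_forall fun s => ?_)
    have := hnorm s
    rw [norm_one, mul_one]
    nlinarith [norm_nonneg (a s), sq_nonneg ‖b s‖]
  have hb1 : b =O[atTop] fun _ : ℝ => (1 : ℝ) := hb.trans inv_isBigO_one
  have hosc1 : (fun s => a s + η * halfOsc z s) =O[atTop] fun _ : ℝ => (1 : ℝ) := by
    refine ha1.add (IsBigO.of_bound ‖η‖ (.of_forall fun s => ?_))
    rw [norm_mul, norm_halfOsc, norm_one]
  have hsq : (fun s => a s ^ 2 - osc z 0 s * η ^ 2) =O[atTop] fun s : ℝ => s⁻¹ := by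
    refine (ha.mul hosc1).congr (fun s => ?_) (fun s => mul_one _)
    rw [osc_plus]; ring
  have hbb : (fun s => b s ^ 2) =O[atTop] fun s : ℝ => s⁻¹ :=
    (hb.mul hb1).congr (fun s => (pow_two _).symm) (fun s => mul_one _)
  have hab' : (fun s => b s * a s) =O[atTop] fun s : ℝ => s⁻¹ :=
    (hb.mul ha1).congr_right fun s => mul_one _
  have habc : (fun s => b s * conj (a s)) =O[atTop] fun s : ℝ => s⁻¹ :=
    (hb.mul (conjO ha1)).congr_right fun s => mul_one _
  have hbbc : (fun s => b s * conj (b s)) =O[atTop] fun s : ℝ => s⁻¹ :=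
    (hb.mul (conjO hb1)).congr_right fun s => mul_one _
  refine ⟨?_, ?_, ?_⟩
  · refine (((hsq.const_mul_left c₀).add ((conjO hbb).const_mul_left c₁)).sub
      ((conjO habc).const_mul_left (r * c₂))).congr_left fun s => ?_
    obtain ⟨h0, h1, h2⟩ := hc s
    rw [← h0, ← h1, ← h2]
    simp only [map_mul, map_pow, Complex.conj_conj]
    linear_combination x s * ((a s * conj (a s)) + (b s * conj (b s)) + 1) * hn s +
      (x s * (a s * conj (a s)) * (b s * conj (b s)) - y s * a s ^ 2 * conj (b s) ^ 2) * hr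
  · refine ((((conjO hsq).const_mul_left c₁).add (hbb.const_mul_left c₀)).add
      (habc.const_mul_left (r * c₂))).congr_left fun s => ?_
    obtain ⟨h0, h1, h2⟩ := hc s
    have hosc : conj (osc z 0 s) = osc z 1 s := by rw [osc_plus, osc_minus, map_pow]
    rw [← h0, ← h1, ← h2]
    simp only [map_sub, map_mul, map_pow, hosc]
    linear_combination y s * ((a s * conj (a s)) + (b s * conj (b s)) + 1) * hn s +
      (y s * (a s * conj (a s)) * (b s * conj (b s)) - x s * conj (a s) ^ 2 * b s ^ 2) * hr
  · refine (((hab'.const_mul_left (r * c₀)).sub ((conjO hab').const_mul_left (r * c₁))).sub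
      (hbbc.const_mul_left (2 * c₂))).congr_left fun s => ?_
    obtain ⟨h0, h1, h2⟩ := hc s
    rw [← h0, ← h1, ← h2, osc_zero]
    simp only [map_mul]
    linear_combination (r * conj (a s) * b s * x s - r * a s * conj (b s) * y s +
      (2 * (b s * conj (b s)) + 1) * w s) * hn s + 2 * (a s * conj (a s)) * (b s * conj (b s)) *
      w s * hr

theorem inv_isBigO_norm_sq_div {z : ℂ} (hz : z ≠ 0) (l : Filter ℝ) :
    (fun s : ℝ => s⁻¹) =O[l] fun s : ℝ => ‖z‖ ^ 2 / s := by
  have hz0 : ‖z‖ ^ 2 ≠ 0 := pow_ne_zero 2 (norm_ne_zero_iff.2 hz)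
  simp only [div_eq_mul_inv]
  exact (isBigO_refl _ l).const_mul_right hz0

theorem eighth_sq : eighth ^ 2 = Complex.I := by
  rw [← Complex.conj_conj eighth, conj_eighth, ← map_pow, eighthInv_sq]
  simp

/-- `S z` is the symmetric square of the two level scattering matrix with rows `(p, t)` and
`(-t̄, p)`. -/
theorem S_eq {z : ℂ} {p : ℝ} {t : ℂ} (hp : p = Real.exp (-Real.pi * ‖z‖ ^ 2 / 4))
    (ht : t = eighth * Ω z * (√(1 - decay z) : ℝ)) :
    S z = !![(p : ℂ) ^ 2, t ^ 2, (√2 : ℝ) * p * t;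
      conj t ^ 2, (p : ℂ) ^ 2, -(√2 : ℝ) * p * conj t;
      -(√2 : ℝ) * p * conj t, (√2 : ℝ) * p * t, 2 * (p : ℂ) ^ 2 - 1] := by
  have hd : decay z = p ^ 2 := by
    rw [decay, hp, ← Real.exp_nat_mul]
    congr 1
    push_cast
    ring
  have hd1 : decay z ≤ 1 := by
    rw [decay, Real.exp_le_one_iff]
    have := Real.pi_pos
    have : 0 ≤ Real.pi * ‖z‖ ^ 2 := by positivity
    linarith
  have hθ : θ z = √(1 - decay z) * p := by rw [θ, decay, ← hp]
  have hsq : ((√(1 - decay z) : ℝ) : ℂ) ^ 2 = 1 - decay z := by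
    exact_mod_cast Real.sq_sqrt (sub_nonneg.2 hd1)
  have hk := eighth_sq
  have hki := eighthInv_sq
  have htc : conj t = eighthInv * conj (Ω z) * (√(1 - decay z) : ℝ) := by
    rw [ht, map_mul, map_mul, conj_eighth, Complex.conj_ofReal]
  have ht2 : t ^ 2 = Complex.I * Ω z ^ 2 * (1 - decay z) := by
    rw [ht, mul_pow, mul_pow, hsq, hk]
  have htc2 : conj t ^ 2 = -Complex.I * conj (Ω z) ^ 2 * (1 - decay z) := by
    rw [htc, mul_pow, mul_pow, hsq, hki]
  have hdc : (decay z : ℂ) = (p : ℂ) ^ 2 := by rw [hd]; push_cast; rfl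
  have e1 : (√2 : ℝ) * eighth * Ω z * θ z = (√2 : ℝ) * p * t := by
    rw [ht, hθ]; push_cast; ring
  have e2 : -(√2 : ℝ) * eighthInv * conj (Ω z) * θ z = -(√2 : ℝ) * p * conj t := by
    rw [htc, hθ]; push_cast; ring
  rw [S, Complex.star_def, e1, e2, ← ht2, ← htc2, hdc]

end PJT

theorem theorem3 (z : ℂ) (hz : z ≠ 0) (v : ℝ → Fin 3 → ℂ) (hv : PJT.IsSolution z v) :
    ∃ α ω : Fin 3 → ℂ,
      (∀ ℓ : Fin 3, (fun s : ℝ => v s ℓ - PJT.osc z ℓ s * α ℓ)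
        =O[Filter.atBot] (fun s : ℝ => ‖z‖ ^ 2 / s)) ∧
      (∀ ℓ : Fin 3, (fun s : ℝ => v s ℓ - PJT.osc z ℓ s * ω ℓ)
        =O[Filter.atTop] (fun s : ℝ => ‖z‖ ^ 2 / s)) ∧
      ω = (PJT.S z).mulVec α := by
  obtain ⟨a, b, η, hab, hnorm, hη, ha, hb, hp, ht⟩ := PJT.exists_normalized_twoLevel hz
  have h := hv.isThreeLevel
  -- The asymptotics at `-∞` are those of the reflected solution at `+∞`.
  obtain ⟨p0, p1, p2⟩ := h.isBigO hab hnorm ha hb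
  obtain ⟨m0, m1, m2⟩ := h.reflect.isBigO hab hnorm ha hb
  simp only [neg_zero] at m0 m1 m2
  have hr : ((√2 : ℝ) : ℂ) ^ 2 = 2 := by exact_mod_cast Real.sq_sqrt zero_le_two
  have hn : a 0 * conj (a 0) + b 0 * conj (b 0) = 1 := by
    rw [Complex.mul_conj', Complex.mul_conj']; exact_mod_cast hnorm 0
  have hηη : η * conj η = 1 := by rw [Complex.mul_conj', hη]; simp
  have hp' : ((‖a 0‖ ^ 2 - ‖b 0‖ ^ 2 : ℝ) : ℂ) = a 0 * conj (a 0) - b 0 * conj (b 0) := by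
    rw [Complex.mul_conj', Complex.mul_conj']; push_cast; rfl
  have hS := PJT.S_eq hp ht
  rw [hp'] at hS
  simp only [map_mul, map_pow, Complex.conj_conj, map_ofNat] at hS
  set r : ℂ := ((√2 : ℝ) : ℂ)
  refine ⟨![η ^ 2 * (conj (a 0) ^ 2 * v 0 0 + conj (b 0) ^ 2 * v 0 1 +
      r * conj (a 0) * conj (b 0) * -v 0 2),
    conj η ^ 2 * (b 0 ^ 2 * v 0 0 + a 0 ^ 2 * v 0 1 - r * a 0 * b 0 * -v 0 2),
    -(-r * conj (a 0) * b 0 * v 0 0 + r * a 0 * conj (b 0) * v 0 1 +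
      (a 0 * conj (a 0) - b 0 * conj (b 0)) * -v 0 2)],
    ![η ^ 2 * (conj (a 0) ^ 2 * v 0 0 + conj (b 0) ^ 2 * v 0 1 +
      r * conj (a 0) * conj (b 0) * v 0 2),
    conj η ^ 2 * (b 0 ^ 2 * v 0 0 + a 0 ^ 2 * v 0 1 - r * a 0 * b 0 * v 0 2),
    -r * conj (a 0) * b 0 * v 0 0 + r * a 0 * conj (b 0) * v 0 1 +
      (a 0 * conj (a 0) - b 0 * conj (b 0)) * v 0 2], ?_, ?_, ?_⟩
  · have flip {f : ℝ → ℂ} (hf : f =O[atTop] fun s : ℝ => s⁻¹) :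
        (fun s => f (-s)) =O[atBot] fun s : ℝ => ‖z‖ ^ 2 / s := by
      refine ((hf.comp_tendsto tendsto_neg_atBot_atTop).trans ?_).trans
        (PJT.inv_isBigO_norm_sq_div hz atBot)
      refine IsBigO.of_bound 1 (.of_forall fun s => ?_)
      simp
    have f0 := flip m0
    have f1 := flip m1
    have f2 := (flip m2).neg_left
    simp only [neg_neg, PJT.osc_neg] at f0 f1 f2
    intro ℓ
    fin_cases ℓ
    · exact f0
    · exact f1
    · refine f2.congr_left fun s => ?_
      simp
      ring
  · intro ℓ
    have ht := PJT.inv_isBigO_norm_sq_div hz atTop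
    fin_cases ℓ
    · exact p0.trans ht
    · exact p1.trans ht
    · exact p2.trans ht
  -- Polynomial identities modulo `|a 0|² + |b 0|² = 1`, `|η| = 1` and `√2 ^ 2 = 2`.
  · rw [hS]
    ext ℓ
    fin_cases ℓ
    · simp [Matrix.mulVec, dotProduct, Fin.sum_univ_three]
      linear_combination -η ^ 2 * (conj (a 0) ^ 2 * v 0 0 + conj (b 0) ^ 2 * v 0 1 +
        r * conj (a 0) * conj (b 0) * v 0 2) *
        ((a 0 * conj (a 0)) + (b 0 * conj (b 0)) + 1) * hn -
      4 * η ^ 2 * conj (a 0) ^ 2 * conj (b 0) ^ 2 *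
        (b 0 ^ 2 * v 0 0 + a 0 ^ 2 * v 0 1 + r * a 0 * b 0 * v 0 2) * (η * conj η + 1) * hηη -
      η ^ 2 * (2 * ((a 0 * conj (a 0)) - (b 0 * conj (b 0))) * (b 0 * conj (b 0)) * conj (a 0)
      ^ 2 * v 0 0 -
        2 * ((a 0 * conj (a 0)) - (b 0 * conj (b 0))) * (a 0 * conj (a 0)) * conj (b 0) ^ 2 *
        v 0 1) * hr
    · simp [Matrix.mulVec, dotProduct, Fin.sum_univ_three]
      linear_combination -conj η ^ 2 * (b 0 ^ 2 * v 0 0 + a 0 ^ 2 * v 0 1 - r * a 0 * b 0 * v 0 2) *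
        ((a 0 * conj (a 0)) + (b 0 * conj (b 0)) + 1) * hn -
      4 * conj η ^ 2 * a 0 ^ 2 * b 0 ^ 2 * (conj (a 0) ^ 2 * v 0 0 + conj (b 0) ^ 2 * v 0 1 -
        r * conj (a 0) * conj (b 0) * v 0 2) * (η * conj η + 1) * hηη -
      conj η ^ 2 * (2 * ((a 0 * conj (a 0)) - (b 0 * conj (b 0))) * (b 0 * conj (b 0)) * a 0 ^ 2 *
      v 0 1 -
        2 * ((a 0 * conj (a 0)) - (b 0 * conj (b 0))) * (a 0 * conj (a 0)) * b 0 ^ 2 * v 0 0) * hr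
    · simp [Matrix.mulVec, dotProduct, Fin.sum_univ_three]
      linear_combination -2 * r * ((a 0 * conj (a 0)) - (b 0 * conj (b 0))) *
        (-a 0 * b 0 * (conj (a 0) ^ 2 * v 0 0 + conj (b 0) ^ 2 * v 0 1 -
        r * conj (a 0) * conj (b 0) * v 0 2) +
        conj (a 0) * conj (b 0) * (b 0 ^ 2 * v 0 0 + a 0 ^ 2 * v 0 1 + r * a 0 * b 0 * v 0 2)) *
        (η * conj η + 1) * hηη -
      2 * ((a 0 * conj (a 0)) - (b 0 * conj (b 0))) * v 0 2 * ((a 0 * conj (a 0)) + (b 0 *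
      conj (b 0)) + 1) * hn -
      4 * ((a 0 * conj (a 0)) - (b 0 * conj (b 0))) * (a 0 * conj (a 0)) * (b 0 * conj (b 0)) *
      v 0 2 * hr
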